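/- Let $N\ge 2$ be an integer, $k>0$ and $\alpha>\frac{N+1}{2}$. Put $\langle x\rangle=(1+|x|^2)^{1/2}$ and $\|w\|_{L^\infty_\beta}=\|\langle\cdot\rangle^{\beta}w\|_{L^\infty(\mathbb R^N)}$ for $\beta\in\mathbb R$ and measurable $w:\mathbb R^N\to\mathbb C$, and let $L^\infty_\beta$ be the space of those $w$ with $\|w\|_{L^\infty_\beta}<\infty$. Functions in $L^\infty(\mathbb R^N)$ are complex-valued. Let $$\Phi_k(x)=\frac{i}{4}\Bigl(\frac{k}{2\pi|x|}\Bigr)^{\frac{N-2}{2}}H^{(1)}_{\frac{N-2}{2}}(k|x|),\qquad x\in\mathbb R^N\setminus\{0\},$$ where $H^{(1)}_\nu$ is the Hankel function of the first kind of order $\nu$, and let $\mathcal R_k h=\Phi_k*h$. Let $\tau(\alpha)=\alpha-\frac{N+1}{2}$ if $\alpha<N$, $\tau(\alpha)=\frac{N-1}{2}$ if $\alpha\ge N$, and $$\kappa_\alpha=\sup\bigl\{\,\bigl\||\Phi_k|*w\bigr\|_{L^\infty_{\tau(\alpha)}} : w\in L^\infty_\alpha,\ \|w\|_{L^\infty_\alpha}=1\,\bigr\}\in[0,\infty].$$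 Let $f:\mathbb R^N\times\mathbb C\to\mathbb C$ be continuous with $$\sup_{|u|\le M,\ x\in\mathbb R^N}\langle x\rangle^{\alpha}|f(x,u)|<\infty\qquad\text{for all } M>0$$ and $$\ell_\alpha:=\sup\Bigl\{\langle x\rangle^{\alpha}\Bigl|\frac{f(x,u)-f(x,v)}{u-v}\Bigr| : x\in\mathbb R^N,\ u,v\in\mathbb C,\ u\ne v\Bigr\}<\frac{1}{\kappa_\alpha}$$ (with $1/\infty=0$, so that this condition includes $\kappa_\alpha<\infty$). Write $N_f(u)(x)=f(x,u(x))$. Then for every $u\in L^\infty(\mathbb R^N)$ the convolution integral defining $\mathcal R_k(N_f(u))(x)$ converges absolutely at every $x\in\mathbb R^N$, and for every $\varphi\in L^\infty(\mathbb R^N)$ (in particular for every bounded solution of the homogeneous Helmholtz equation $\Delta\varphi+k^2\varphi=0$) the equation $$u=\mathcal R_k\bigl(N_f(u)\bigr)+\varphi\qquad\text{in } L^\infty(\mathbb R^N)$$ has exactly one solution $u\in L^\infty(\mathbb R^N)$. -/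

import Mathlib

open MeasureTheory
open scoped ENNReal

/-- The Hankel function of the first kind `H^{(1)}_ν(z)` of real order `ν > -1/2` at `z > 0`,
given by Hankel's integral
`H^{(1)}_ν(z) = (2/(πz))^{1/2} e^{i(z - νπ/2 - π/4)} / Γ(ν + 1/2)
  * ∫_0^∞ e^{-t} t^{ν - 1/2} (1 + i t/(2z))^{ν - 1/2} dt`
(principal branch of the power; `1 + i t/(2z)` has real part `1`). -/
noncomputable def hankelOne (ν z : ℝ) : ℂ :=
  ((Real.sqrt (2 / (Real.pi * z)) : ℝ) : ℂ)
    * Complex.exp (Complex.I * ((z - ν * Real.pi / 2 - Real.pi / 4 : ℝ) : ℂ))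
    / ((Real.Gamma (ν + 1 / 2) : ℝ) : ℂ)
    * ∫ t in Set.Ioi (0 : ℝ), ((Real.exp (-t) * t ^ (ν - 1 / 2) : ℝ) : ℂ)
        * (1 + Complex.I * ((t / (2 * z) : ℝ) : ℂ)) ^ ((ν - 1 / 2 : ℝ) : ℂ)

section HankelFacts

open Set Filter Topology

theorem hk_cpow_norm (c w : ℝ) (hw : 0 ≤ w) (m : ℕ) (hm : |c| ≤ m) :
    ‖(1 + Complex.I * ((w : ℝ) : ℂ)) ^ ((c : ℝ) : ℂ)‖ ≤ (1 + w) ^ m := by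
  have h1 : (1:ℝ) ≤ ‖(1 + Complex.I * ((w : ℝ) : ℂ))‖ := by
    have := Complex.abs_re_le_norm (1 + Complex.I * ((w : ℝ) : ℂ))
    simpa using this
  have h2 : ‖(1 + Complex.I * ((w : ℝ) : ℂ))‖ ≤ 1 + w := by
    refine (norm_add_le _ _).trans ?_
    simp [abs_of_nonneg hw]
  have hne : (1 + Complex.I * ((w : ℝ) : ℂ)) ≠ 0 := by
    intro h; rw [h] at h1; norm_num at h1
  rw [Complex.norm_cpow_of_ne_zero hne]
  simp only [Complex.ofReal_re, Complex.ofReal_im, mul_zero, Real.exp_zero, div_one]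
  calc _ ≤ ‖(1 + Complex.I * ((w : ℝ) : ℂ))‖ ^ (m:ℝ) :=
        Real.rpow_le_rpow_of_exponent_le h1 ((le_abs_self c).trans hm)
    _ = ‖(1 + Complex.I * ((w : ℝ) : ℂ))‖ ^ m := Real.rpow_natCast _ _
    _ ≤ _ := by gcongr

theorem hk_int (b z : ℝ) (hb : -1 < b) (hz : 0 < z) (m : ℕ) :
    IntegrableOn (fun s : ℝ => s ^ b * Real.exp (-(z * s)) * (1 + s) ^ m) (Ioi 0) := by
  have : IntegrableOn (fun s : ℝ => ∑ j ∈ Finset.range (m+1),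
      (m.choose j : ℝ) * (s ^ (b + (m - j : ℕ)) * Real.exp (-z * s ^ (1:ℝ)))) (Ioi 0) := by
    refine integrable_finsetSum _ fun j _ => Integrable.const_mul ?_ _
    exact integrableOn_rpow_mul_exp_neg_mul_rpow (by
      have : (0:ℝ) ≤ (m - j : ℕ) := Nat.cast_nonneg _
      linarith) one_pos hz
  refine this.congr_fun (fun s hs => ?_) measurableSet_Ioi
  have hs' : (0:ℝ) < s := hs
  simp only [add_pow, one_pow, one_mul, Finset.mul_sum]
  refine Finset.sum_congr rfl fun j _ => ?_
  rw [Real.rpow_add hs', Real.rpow_natCast, Real.rpow_one]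
  ring_nf

/-- The integrand `s^b e^{-zs} (1 + is/2)^c` of the rescaled Hankel integral. -/
noncomputable def hkKer (b c z s : ℝ) : ℂ :=
  ((s ^ b * Real.exp (-(z * s)) : ℝ) : ℂ) * (1 + Complex.I * ((s / 2 : ℝ) : ℂ)) ^ ((c : ℝ) : ℂ)

theorem hkKer_meas (b c z : ℝ) : Measurable (hkKer b c z) := by
  unfold hkKer; fun_prop

theorem hkKer_norm (b c z s : ℝ) (hs : 0 < s) (m : ℕ) (hm : |c| ≤ m) :
    ‖hkKer b c z s‖ ≤ s ^ b * Real.exp (-(z * s)) * (1 + s) ^ m := by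
  unfold hkKer
  rw [norm_mul, Complex.norm_real, Real.norm_of_nonneg (by positivity)]
  gcongr
  refine (hk_cpow_norm c (s/2) (by positivity) m hm).trans ?_
  gcongr; linarith

theorem hkKer_int (b c z : ℝ) (hb : -1 < b) (hz : 0 < z) :
    IntegrableOn (hkKer b c z) (Ioi 0) := by
  obtain ⟨m, hm⟩ := exists_nat_ge |c|
  refine Integrable.mono' (hk_int b z hb hz m) (hkKer_meas b c z).aestronglyMeasurable ?_
  filter_upwards [self_mem_ae_restrict measurableSet_Ioi] with s hs
  exact hkKer_norm b c z s hs m hm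

theorem hkKer_deriv (b c z : ℝ) (hb : -1 < b) (hz : 0 < z) :
    HasDerivAt (fun z => ∫ s in Ioi (0:ℝ), hkKer b c z s)
      (-∫ s in Ioi (0:ℝ), hkKer (b+1) c z s) z := by
  obtain ⟨m, hm⟩ := exists_nat_ge |c|
  rw [← integral_neg]
  refine (hasDerivAt_integral_of_dominated_loc_of_deriv_le
    (F := fun z s => hkKer b c z s) (F' := fun z s => - hkKer (b+1) c z s)
    (bound := fun s : ℝ => s ^ (b+1) * Real.exp (-(z / 2 * s)) * (1 + s) ^ m)
    (s := Ioi (z/2)) (Ioi_mem_nhds (by linarith))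
    (Eventually.of_forall fun z => (hkKer_meas b c z).aestronglyMeasurable)
    (hkKer_int b c z hb hz) (hkKer_meas (b+1) c z).neg.aestronglyMeasurable ?_
    (hk_int (b+1) (z/2) (by linarith) (by linarith) m) ?_).2
  · filter_upwards [self_mem_ae_restrict measurableSet_Ioi] with s hs y hy
    have hs' : (0:ℝ) < s := hs
    have hy' : z/2 < y := hy
    rw [norm_neg]
    refine (hkKer_norm (b+1) c y s hs m hm).trans ?_
    gcongr
  · filter_upwards [self_mem_ae_restrict measurableSet_Ioi] with s hs y hy
    have hs' : (0:ℝ) < s := hs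
    have h1 : HasDerivAt (fun y : ℝ => s ^ b * Real.exp (-(y * s)))
        (s ^ b * (Real.exp (-(y * s)) * (-(1 * s)))) y :=
      (((hasDerivAt_id y).mul_const s).neg.exp).const_mul _
    have h2 := (h1.ofReal_comp).mul_const ((1 + Complex.I * ((s / 2 : ℝ) : ℂ)) ^ ((c : ℝ) : ℂ))
    refine h2.congr_deriv ?_
    unfold hkKer
    rw [Real.rpow_add hs', Real.rpow_one]
    push_cast
    ring

theorem hk_ibp (a z : ℝ) (ha : -1 < a) (hz : 0 < z) :
    (z : ℂ) * (∫ s in Ioi (0:ℝ), hkKer (a+1+1) a z s)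
      - (2 * (a + 1) + 2 * Complex.I * z) * (∫ s in Ioi (0:ℝ), hkKer (a+1) a z s)
      + 2 * (a + 1) * Complex.I * (∫ s in Ioi (0:ℝ), hkKer a a z s) = 0 := by
  have i0 := hkKer_int a a z ha hz
  have i1 := hkKer_int (a+1) a z (by linarith) hz
  have i2 := hkKer_int (a+1+1) a z (by linarith) hz
  have hF : ∀ s ∈ Ioi (0:ℝ), HasDerivAt (fun s => 2 * Complex.I * hkKer (a+1) (a+1) z s)
      ((z : ℂ) * hkKer (a+1+1) a z s - (2 * (a + 1) + 2 * Complex.I * z) * hkKer (a+1) a z s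
        + 2 * (a + 1) * Complex.I * hkKer a a z s) s := by
    intro s hs
    have hs' : (0:ℝ) < s := hs
    have h1 : HasDerivAt (fun s : ℝ => s ^ (a+1) * Real.exp (-(z * s)))
        ((a+1) * s ^ (a+1-1) * Real.exp (-(z*s))
          + s ^ (a+1) * (Real.exp (-(z * s)) * (-(z * 1)))) s :=
      (Real.hasDerivAt_rpow_const (Or.inl hs'.ne')).mul
        (((hasDerivAt_id s).const_mul z).neg.exp)
    have h3 : HasDerivAt (fun s : ℝ => 1 + Complex.I * ((s / 2 : ℝ) : ℂ))
        (Complex.I * ((1 / 2 : ℝ) : ℂ)) s :=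
      ((((hasDerivAt_id s).div_const 2).ofReal_comp).const_mul Complex.I).const_add 1
    have hmem : (1 + Complex.I * ((s / 2 : ℝ) : ℂ)) ∈ Complex.slitPlane := by
      left; simp
    have h4 := HasDerivAt.comp s
      ((hasDerivAt_id (1 + Complex.I * ((s / 2 : ℝ) : ℂ))).cpow_const (c := ((a+1 : ℝ) : ℂ)) hmem)
      h3
    simp only [id, Function.comp_def, mul_one] at h4
    have h5 := ((h1.ofReal_comp).mul h4).const_mul (2 * Complex.I)
    refine h5.congr_deriv ?_
    have hne : (1 + Complex.I * ((s / 2 : ℝ) : ℂ)) ≠ 0 := Complex.slitPlane_ne_zero hmem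
    have e1 : (1 + Complex.I * ((s / 2 : ℝ) : ℂ)) ^ ((a + 1 : ℝ) : ℂ)
        = (1 + Complex.I * ((s / 2 : ℝ) : ℂ)) ^ ((a : ℝ) : ℂ)
          * (1 + Complex.I * ((s / 2 : ℝ) : ℂ)) := by
      rw [Complex.ofReal_add, Complex.cpow_add _ _ hne]; simp
    have e2 : (((a + 1 : ℝ) : ℂ) - 1) = (a : ℂ) := by push_cast; ring
    rw [e2, e1]
    unfold hkKer
    rw [show a + 1 - 1 = a by ring, Real.rpow_add hs' (a+1) 1, Real.rpow_add hs' a 1, Real.rpow_one]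
    generalize (1 + Complex.I * ((s / 2 : ℝ) : ℂ)) ^ ((a : ℝ) : ℂ) = q
    push_cast
    linear_combination (norm := ring_nf)
      (0:ℂ) * Complex.I_sq
    simp only [Complex.I_sq]
    ring
  have hI : IntegrableOn (fun s => (z : ℂ) * hkKer (a+1+1) a z s
      - (2 * (a + 1) + 2 * Complex.I * z) * hkKer (a+1) a z s
        + 2 * (a + 1) * Complex.I * hkKer a a z s) (Ioi 0) :=
    ((i2.const_mul _).sub (i1.const_mul _)).add (i0.const_mul _)
  have hlim := tendsto_zero_of_hasDerivAt_of_integrableOn_Ioi hF hI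
    ((hkKer_int (a+1) (a+1) z (by linarith) hz).const_mul _)
  have hc : ContinuousWithinAt (fun s => 2 * Complex.I * hkKer (a+1) (a+1) z s) (Ici 0) 0 := by
    apply ContinuousAt.continuousWithinAt
    unfold hkKer
    have : ContinuousAt (fun s : ℝ => (1 + Complex.I * ((s / 2 : ℝ) : ℂ)) ^ ((a + 1 : ℝ) : ℂ)) 0 := by
      refine ContinuousAt.cpow (by fun_prop) continuousAt_const (by left; simp)
    have h2 : ContinuousAt (fun s : ℝ => s ^ (a+1)) 0 :=
      Real.continuousAt_rpow_const _ _ (Or.inr (by linarith))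
    have h3 : ContinuousAt (fun s : ℝ => ((s ^ (a+1) * Real.exp (-(z * s)) : ℝ) : ℂ)) 0 :=
      Complex.continuous_ofReal.continuousAt.comp (h2.mul (by fun_prop))
    exact continuousAt_const.mul (h3.mul this)
  have h := integral_Ioi_of_hasDerivAt_of_tendsto hc hF hI hlim
  rw [← integral_const_mul, ← integral_const_mul, ← integral_const_mul,
    ← integral_sub (i2.const_mul _) (i1.const_mul _)]
  refine (integral_add ((i2.const_mul _).sub (i1.const_mul _)) (i0.const_mul _)).symm.trans ?_
  refine h.trans ?_
  simp [hkKer, Real.zero_rpow (show a + 1 ≠ 0 by linarith)]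

theorem hankelOne_eq (ν z : ℝ) (hz : 0 < z) :
    hankelOne ν z = (((Real.sqrt (2 / Real.pi) : ℝ) : ℂ)
      * Complex.exp (-Complex.I * ((ν * Real.pi / 2 + Real.pi / 4 : ℝ) : ℂ))
      / ((Real.Gamma (ν + 1 / 2) : ℝ) : ℂ)) *
      (((z ^ ν : ℝ) : ℂ) * Complex.exp (Complex.I * z)
        * ∫ s in Ioi (0:ℝ), hkKer (ν - 1/2) (ν - 1/2) z s) := by
  have h := integral_comp_mul_left_Ioi (fun t : ℝ =>
    ((Real.exp (-t) * t ^ (ν - 1 / 2) : ℝ) : ℂ)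
        * (1 + Complex.I * ((t / (2 * z) : ℝ) : ℂ)) ^ ((ν - 1 / 2 : ℝ) : ℂ)) 0 hz
  rw [mul_zero] at h
  have h' : (∫ t in Ioi (0:ℝ), ((Real.exp (-t) * t ^ (ν - 1 / 2) : ℝ) : ℂ)
        * (1 + Complex.I * ((t / (2 * z) : ℝ) : ℂ)) ^ ((ν - 1 / 2 : ℝ) : ℂ))
      = ((z ^ (ν + 1/2) : ℝ) : ℂ) * ∫ s in Ioi (0:ℝ), hkKer (ν - 1/2) (ν - 1/2) z s := by
    rw [eq_inv_smul_iff₀ hz.ne'] at h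
    rw [← h, ← integral_smul, ← integral_const_mul]
    refine setIntegral_congr_fun measurableSet_Ioi fun s hs => ?_
    have hs' : (0:ℝ) < s := hs
    simp only [hkKer]
    rw [show z * s / (2 * z) = s / 2 by field_simp, Real.mul_rpow hz.le hs'.le,
      show ν + 1/2 = (ν - 1/2) + 1 by ring, Real.rpow_add hz, Real.rpow_one, Complex.real_smul]
    push_cast
    ring
  have e : Complex.exp (Complex.I * ((z - ν * Real.pi / 2 - Real.pi / 4 : ℝ) : ℂ))
      = Complex.exp (-Complex.I * ((ν * Real.pi / 2 + Real.pi / 4 : ℝ) : ℂ))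
        * Complex.exp (Complex.I * z) := by
    rw [← Complex.exp_add]; congr 1; push_cast; ring
  have e2 : Real.sqrt (2 / (Real.pi * z)) * z ^ (ν + 1/2) = Real.sqrt (2 / Real.pi) * z ^ ν := by
    rw [← div_div, Real.sqrt_div' _ hz.le, Real.sqrt_eq_rpow z, Real.rpow_add hz]
    have : z ^ ((1:ℝ)/2) ≠ 0 := by positivity
    field_simp
  have e3 : ((Real.sqrt (2 / (Real.pi * z)) : ℝ) : ℂ) * ((z ^ (ν + 1/2) : ℝ) : ℂ)
      = ((Real.sqrt (2 / Real.pi) : ℝ) : ℂ) * ((z ^ ν : ℝ) : ℂ) := by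
    exact_mod_cast e2
  unfold hankelOne
  rw [h', e]
  linear_combination (Complex.exp (-Complex.I * ((ν * Real.pi / 2 + Real.pi / 4 : ℝ) : ℂ))
        * Complex.exp (Complex.I * z) / ((Real.Gamma (ν + 1 / 2) : ℝ) : ℂ)
        * ∫ s in Ioi (0:ℝ), hkKer (ν - 1/2) (ν - 1/2) z s) * e3

/-- `H^{(1)}_ν` solves Bessel's equation `z² H'' + z H' + (z² - ν²) H = 0` on `(0, ∞)`. -/
theorem hankelOne_bessel (ν : ℝ) (hν : -(1 / 2) < ν) :
    ∃ H₁ H₂ : ℝ → ℂ, ∀ z : ℝ, 0 < z →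
      HasDerivAt (hankelOne ν) (H₁ z) z ∧ HasDerivAt H₁ (H₂ z) z ∧
      (z : ℂ) ^ 2 * H₂ z + z * H₁ z + ((z : ℂ) ^ 2 - (ν : ℂ) ^ 2) * hankelOne ν z = 0 := by
  obtain ⟨C, hC⟩ : ∃ C : ℂ, ∀ z : ℝ, 0 < z → hankelOne ν z = C *
      (((z ^ ν : ℝ) : ℂ) * Complex.exp (Complex.I * z)
        * ∫ s in Ioi (0:ℝ), hkKer (ν - 1/2) (ν - 1/2) z s) :=
    ⟨_, fun z hz => hankelOne_eq ν z hz⟩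
  set a := ν - 1/2 with ha
  have ha' : -1 < a := by rw [ha]; linarith
  have hG0 := fun z hz => hkKer_deriv a a z ha' hz
  have hG1 := fun z hz => hkKer_deriv (a+1) a z (by linarith) hz
  have hode := fun z hz => hk_ibp a z ha' hz
  set G0 := fun z => ∫ s in Ioi (0:ℝ), hkKer a a z s with hG0d
  set G1 := fun z => ∫ s in Ioi (0:ℝ), hkKer (a+1) a z s with hG1d
  set G2 := fun z => ∫ s in Ioi (0:ℝ), hkKer (a+1+1) a z s with hG2d
  have hp : ∀ z : ℝ, 0 < z → HasDerivAt (fun z : ℝ => ((z ^ ν : ℝ) : ℂ))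
      ((ν : ℂ) / z * ((z ^ ν : ℝ) : ℂ)) z := by
    intro z hz
    refine ((Real.hasDerivAt_rpow_const (Or.inl hz.ne')).ofReal_comp).congr_deriv ?_
    rw [Real.rpow_sub hz, Real.rpow_one]; push_cast; ring
  have he : ∀ z : ℝ, HasDerivAt (fun z : ℝ => Complex.exp (Complex.I * z))
      (Complex.exp (Complex.I * z) * (Complex.I * 1)) z := fun z =>
    (((hasDerivAt_id z).ofReal_comp).const_mul Complex.I).cexp
  have hq : ∀ z : ℝ, 0 < z → HasDerivAt (fun z : ℝ => (ν : ℂ) / z) (-(ν : ℂ) / z ^ 2) z := by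
    intro z hz
    have := (((hasDerivAt_id z).ofReal_comp).inv (by simpa using hz.ne')).const_mul (ν : ℂ)
    refine this.congr_deriv ?_
    simp; ring
  refine ⟨fun z => C * (((z ^ ν : ℝ) : ℂ) * Complex.exp (Complex.I * z)
      * (((ν : ℂ) / z + Complex.I) * G0 z - G1 z)),
    fun z => C * (((z ^ ν : ℝ) : ℂ) * Complex.exp (Complex.I * z)
      * (((ν : ℂ) / z + Complex.I) * (((ν : ℂ) / z + Complex.I) * G0 z - G1 z)
        + (-(ν : ℂ) / z ^ 2 * G0 z - ((ν : ℂ) / z + Complex.I) * G1 z + G2 z))),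
    fun z hz => ⟨?_, ?_, ?_⟩⟩
  · have h := ((((hp z hz).mul (he z)).mul (hG0 z hz)).const_mul C)
    refine (h.congr_of_eventuallyEq ?_).congr_deriv ?_
    · filter_upwards [Ioi_mem_nhds hz] with y hy using hC y hy
    · simp only [Pi.mul_apply]
      ring
  · have h := (((hp z hz).mul (he z)).mul
      ((((hq z hz).add_const Complex.I).mul (hG0 z hz)).sub (hG1 z hz))).const_mul C
    refine h.congr_deriv ?_
    simp only [Pi.mul_apply, Pi.sub_apply]
    ring
  · have hz' : (z : ℂ) ≠ 0 := by exact_mod_cast hz.ne'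
    rw [hC z hz]
    have h := hode z hz
    change (z : ℂ) * G2 z - (2 * (a + 1) + 2 * Complex.I * z) * G1 z
      + 2 * (a + 1) * Complex.I * G0 z = 0 at h
    change _ + ((z : ℂ) ^ 2 - (ν : ℂ) ^ 2) * (C * (_ * G0 z)) = 0
    rw [ha] at h
    push_cast at h
    field_simp
    linear_combination (norm := ring_nf) (C * ((z ^ ν : ℝ) : ℂ) * Complex.exp (Complex.I * z) * z) * h
    simp only [Complex.I_sq]
    ring

/-- `H^{(1)}_ν(z) ~ (2/(πz))^{1/2} e^{i(z - νπ/2 - π/4)}` as `z → ∞`. Together with Bessel's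
equation this determines `H^{(1)}_ν`, so `hankelOne` is the usual Hankel function. -/
theorem hankelOne_asymp (ν : ℝ) (hν : -(1 / 2) < ν) :
    Tendsto (fun z : ℝ => hankelOne ν z / (((Real.sqrt (2 / (Real.pi * z)) : ℝ) : ℂ)
      * Complex.exp (Complex.I * ((z - ν * Real.pi / 2 - Real.pi / 4 : ℝ) : ℂ)))) atTop (𝓝 1) := by
  have hΓ : 0 < Real.Gamma (ν + 1/2) := Real.Gamma_pos_of_pos (by linarith)
  obtain ⟨m, hm⟩ := exists_nat_ge |ν - 1/2|
  have hT : Tendsto (fun z : ℝ => ∫ t in Ioi (0 : ℝ),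
      ((Real.exp (-t) * t ^ (ν - 1 / 2) : ℝ) : ℂ)
        * (1 + Complex.I * ((t / (2 * z) : ℝ) : ℂ)) ^ ((ν - 1 / 2 : ℝ) : ℂ)) atTop
      (𝓝 (∫ t in Ioi (0 : ℝ), ((Real.exp (-t) * t ^ (ν - 1 / 2) : ℝ) : ℂ))) := by
    refine tendsto_integral_filter_of_dominated_convergence
      (fun t : ℝ => t ^ (ν - 1/2) * Real.exp (-(1 * t)) * (1 + t) ^ m)
      (Eventually.of_forall fun z => by
        refine Measurable.aestronglyMeasurable ?_; fun_prop) ?_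
      (hk_int (ν - 1/2) 1 (by linarith) one_pos m) ?_
    · filter_upwards [eventually_ge_atTop (1:ℝ)] with z hz
      filter_upwards [self_mem_ae_restrict measurableSet_Ioi] with t ht
      have ht' : (0:ℝ) < t := ht
      rw [norm_mul, Complex.norm_real, Real.norm_of_nonneg (by positivity), one_mul,
        mul_comm (Real.exp (-t))]
      gcongr
      refine (hk_cpow_norm _ (t / (2*z)) (by positivity) m hm).trans ?_
      gcongr
      exact div_le_self ht'.le (by linarith)
    · filter_upwards with t
      have h1 : Tendsto (fun z : ℝ => t / (2 * z)) atTop (𝓝 0) :=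
        Tendsto.const_div_atTop (tendsto_id.const_mul_atTop two_pos) t
      have h2 : Tendsto (fun z : ℝ => 1 + Complex.I * ((t / (2 * z) : ℝ) : ℂ)) atTop (𝓝 1) := by
        have := ((Complex.continuous_ofReal.tendsto 0).comp h1).const_mul Complex.I
        simpa [Function.comp_def] using this.const_add 1
      have h3 := h2.cpow (tendsto_const_nhds (x := ((ν - 1 / 2 : ℝ) : ℂ))) (by left; simp)
      simpa using h3.const_mul ((Real.exp (-t) * t ^ (ν - 1 / 2) : ℝ) : ℂ)
  have hG : (∫ t in Ioi (0 : ℝ), ((Real.exp (-t) * t ^ (ν - 1 / 2) : ℝ) : ℂ))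
      = ((Real.Gamma (ν + 1/2) : ℝ) : ℂ) := by
    rw [integral_complex_ofReal, Real.Gamma_eq_integral (by linarith)]
    congr 3; ext t; congr 2; ring
  rw [hG] at hT
  have h := hT.div_const ((Real.Gamma (ν + 1/2) : ℝ) : ℂ)
  rw [div_self (by exact_mod_cast hΓ.ne')] at h
  refine h.congr' ?_
  filter_upwards [eventually_gt_atTop (0:ℝ)] with z hz
  have : ((Real.sqrt (2 / (Real.pi * z)) : ℝ) : ℂ) ≠ 0 := by
    have : 0 < Real.sqrt (2 / (Real.pi * z)) := Real.sqrt_pos.2 (by positivity)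
    exact_mod_cast this.ne'
  have h2 := Complex.exp_ne_zero (Complex.I * ((z - ν * Real.pi / 2 - Real.pi / 4 : ℝ) : ℂ))
  unfold hankelOne
  generalize (∫ t in Ioi (0 : ℝ), ((Real.exp (-t) * t ^ (ν - 1 / 2) : ℝ) : ℂ)
        * (1 + Complex.I * ((t / (2 * z) : ℝ) : ℂ)) ^ ((ν - 1 / 2 : ℝ) : ℂ)) = J
  generalize ((Real.Gamma (ν + 1 / 2) : ℝ) : ℂ) = Γ'
  generalize ((Real.sqrt (2 / (Real.pi * z)) : ℝ) : ℂ) = S at *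
  generalize Complex.exp (Complex.I * ((z - ν * Real.pi / 2 - Real.pi / 4 : ℝ) : ℂ)) = E at *
  field_simp

end HankelFacts

/-- The outgoing fundamental solution of the Helmholtz equation in `ℝ^N`,
`Φ_k(x) = (i/4) (k/(2π|x|))^{(N-2)/2} H^{(1)}_{(N-2)/2}(k|x|)` for `x ≠ 0`. -/
noncomputable def helmholtzFund {N : ℕ} (k : ℝ) (x : EuclideanSpace ℝ (Fin N)) : ℂ :=
  (Complex.I / 4) * (((k / (2 * Real.pi * ‖x‖)) ^ (((N : ℝ) - 2) / 2) : ℝ) : ℂ)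
    * hankelOne (((N : ℝ) - 2) / 2) (k * ‖x‖)

/-- The Japanese bracket `⟨x⟩ = (1 + |x|²)^{1/2}`. -/
noncomputable def japaneseBracket {N : ℕ} (x : EuclideanSpace ℝ (Fin N)) : ℝ :=
  Real.sqrt (1 + ‖x‖ ^ 2)

/-- The weighted norm `‖w‖_{L^∞_β} = ‖⟨·⟩^β w‖_{L^∞(ℝ^N)}`, with value `∞` if `w ∉ L^∞_β`. -/
noncomputable def weightedSupNorm {N : ℕ} (β : ℝ) (w : EuclideanSpace ℝ (Fin N) → ℂ) : ℝ≥0∞ :=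
  eLpNorm (fun x => japaneseBracket x ^ β • w x) ∞ volume

/-- The exponent `τ(α)`: it is `α - (N+1)/2` if `(N+1)/2 < α < N` and `(N-1)/2` if `α ≥ N`. -/
noncomputable def decayExponent (N : ℕ) (α : ℝ) : ℝ :=
  if α < N then α - ((N : ℝ) + 1) / 2 else ((N : ℝ) - 1) / 2

/-- `κ_α = sup { ‖ |Φ_k| * w ‖_{L^∞_{τ(α)}} : w ∈ L^∞_α(ℝ^N), ‖w‖_{L^∞_α} = 1 }`. -/
noncomputable def kappaConst (N : ℕ) (k α : ℝ) : ℝ≥0∞ :=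
  ⨆ (w : EuclideanSpace ℝ (Fin N) → ℂ) (_ : AEStronglyMeasurable w volume)
    (_ : weightedSupNorm α w = 1),
    weightedSupNorm (decayExponent N α)
      (convolution (fun x => ‖helmholtzFund k x‖) w (ContinuousLinearMap.lsmul ℝ ℝ) volume)

/-- The Helmholtz resolvent `R_k h = Φ_k * h`. -/
noncomputable def helmholtzResolvent {N : ℕ} (k : ℝ) (h : EuclideanSpace ℝ (Fin N) → ℂ) :
    EuclideanSpace ℝ (Fin N) → ℂ :=
  convolution (helmholtzFund k) h (ContinuousLinearMap.mul ℂ ℂ) volume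

/-- The substitution operator `N_f(u)(x) = f(x, u(x))`. -/
def substitution {N : ℕ} (f : EuclideanSpace ℝ (Fin N) → ℂ → ℂ)
    (u : EuclideanSpace ℝ (Fin N) → ℂ) : EuclideanSpace ℝ (Fin N) → ℂ :=
  fun x => f x (u x)

/-- `ℓ_α = sup { ⟨x⟩^α |(f(x,u) - f(x,v)) / (u - v)| : x ∈ ℝ^N, u, v ∈ ℂ, u ≠ v }`, with value
`∞` if the set is unbounded. -/
noncomputable def weightedLipConst {N : ℕ} (α : ℝ) (f : EuclideanSpace ℝ (Fin N) → ℂ → ℂ) :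
    ℝ≥0∞ :=
  ⨆ (x : EuclideanSpace ℝ (Fin N)) (u : ℂ) (v : ℂ) (_ : u ≠ v),
    ENNReal.ofReal (japaneseBracket x ^ α * ‖(f x u - f x v) / (u - v)‖)

/-! The solutions are the fixed points of `T u = R_k(N_f(u)) + φ` on `L^∞`, and `T` is a contraction
with constant `ℓ_α κ_α < 1`, so Banach's theorem applies. By definition of `ℓ_α`, the difference
`N_f(u) - N_f(v)` is at most `ℓ_α ‖u - v‖ ⟨·⟩^{-α}` a.e. The weight `⟨·⟩^{-α}` is itself a
competitor in the supremum defining `κ_α`, and `τ(α) ≥ 0`, so `|Φ_k| * ⟨·⟩^{-α} ≤ κ_α` a.e.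
(`ae_integral_norm_helmholtzFund_le_kappaConst`).

Finiteness of `κ_α` alone does not give convergence, because a Bochner integral of a non-integrable
function is `0`. Absolute convergence at every point is therefore proved separately, in
`integrable_norm_helmholtzFund_mul_japaneseBracket`. Hankel's integral bounds `|Φ_k|` by
`|x|^{-(N-1)/2} + |x|^{-s}` with `s = max (N-2) ((N-1)/2)`. Both exponents are below `N`, so the
origin is harmless. Both are at least `(N-1)/2`, so together with `α > (N+1)/2` the decay at
infinity exceeds `N`. -/

/-! ### Size of the Hankel function and of the fundamental solution -/

theorem one_add_rpow_le_two_rpow_mul {w p : ℝ} (hw : 0 ≤ w) (hp : 0 ≤ p) :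
    (1 + w) ^ p ≤ 2 ^ p * (1 + w ^ p) := by
  rcases le_total w 1 with h | h
  · calc (1 + w) ^ p ≤ 2 ^ p := Real.rpow_le_rpow (by positivity) (by linarith) hp
      _ ≤ 2 ^ p * (1 + w ^ p) :=
        le_mul_of_one_le_right (by positivity) (by linarith [Real.rpow_nonneg hw p])
  · calc (1 + w) ^ p ≤ (2 * w) ^ p := Real.rpow_le_rpow (by positivity) (by linarith) hp
      _ = 2 ^ p * w ^ p := Real.mul_rpow two_pos.le hw
      _ ≤ 2 ^ p * (1 + w ^ p) := by gcongr; linarith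

/-- The base has modulus at least `1`, so the exponent may be raised from `c` to `p`. This allows `c
< 0`, which occurs for `N = 2`. -/
theorem norm_one_add_I_mul_cpow_le {c p w : ℝ} (hw : 0 ≤ w) (hp : 0 ≤ p) (hcp : c ≤ p) :
    ‖(1 + Complex.I * ((w : ℝ) : ℂ)) ^ ((c : ℝ) : ℂ)‖ ≤ 2 ^ p * (1 + w ^ p) := by
  have h1 : (1 : ℝ) ≤ ‖(1 + Complex.I * ((w : ℝ) : ℂ))‖ := by
    simpa using Complex.abs_re_le_norm (1 + Complex.I * ((w : ℝ) : ℂ))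
  have h2 : ‖(1 + Complex.I * ((w : ℝ) : ℂ))‖ ≤ 1 + w := by
    refine (norm_add_le _ _).trans ?_
    simp [abs_of_nonneg hw]
  rw [Complex.norm_cpow_real]
  calc _ ≤ ‖(1 + Complex.I * ((w : ℝ) : ℂ))‖ ^ p := Real.rpow_le_rpow_of_exponent_le h1 hcp
    _ ≤ (1 + w) ^ p := by gcongr
    _ ≤ _ := one_add_rpow_le_two_rpow_mul hw hp

/-- Away from the oscillation, `H^{(1)}_ν` is bounded by `z^{-1/2}` at infinity, up to a power
`z^{-p}` that takes the singularity at the origin into account. -/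
theorem exists_norm_hankelOne_le {ν p : ℝ} (hν : -(1 / 2) < ν) (hp : 0 ≤ p) (hνp : ν - 1 / 2 ≤ p) :
    ∃ C : ℝ, 0 ≤ C ∧ ∀ z : ℝ, 0 < z →
      ‖hankelOne ν z‖ ≤ C * (z ^ (-(1 / 2) : ℝ) + z ^ (-(1 / 2) - p)) := by
  have hg1 : IntegrableOn (fun t : ℝ => Real.exp (-t) * t ^ (ν - 1 / 2)) (Set.Ioi 0) := by
    have := Real.GammaIntegral_convergent (s := ν + 1 / 2) (by linarith)
    rwa [show ν + 1 / 2 - 1 = ν - 1 / 2 by ring] at this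
  have hg2 : IntegrableOn (fun t : ℝ => Real.exp (-t) * t ^ (ν - 1 / 2 + p)) (Set.Ioi 0) := by
    have := Real.GammaIntegral_convergent (s := ν + 1 / 2 + p) (by linarith)
    rwa [show ν + 1 / 2 + p - 1 = ν - 1 / 2 + p by ring] at this
  -- `A` and `B` are the Gamma integrals `Γ(ν + 1/2)` and `Γ(ν + 1/2 + p)`.
  set A := ∫ t in Set.Ioi (0 : ℝ), Real.exp (-t) * t ^ (ν - 1 / 2)
  set B := ∫ t in Set.Ioi (0 : ℝ), Real.exp (-t) * t ^ (ν - 1 / 2 + p)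
  have hA : 0 ≤ A := setIntegral_nonneg measurableSet_Ioi fun t ht => by
    have : (0 : ℝ) < t := ht
    positivity
  have hB : 0 ≤ B := setIntegral_nonneg measurableSet_Ioi fun t ht => by
    have : (0 : ℝ) < t := ht
    positivity
  have hint : ∀ z : ℝ, 0 < z → ‖∫ t in Set.Ioi (0 : ℝ),
      ((Real.exp (-t) * t ^ (ν - 1 / 2) : ℝ) : ℂ)
        * (1 + Complex.I * ((t / (2 * z) : ℝ) : ℂ)) ^ ((ν - 1 / 2 : ℝ) : ℂ)‖
      ≤ 2 ^ p * (A + B) * (1 + z ^ (-p)) := by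
    intro z hz
    have hz' : 0 < z ^ (-p) := by positivity
    calc _ ≤ ∫ t in Set.Ioi (0 : ℝ), (2 ^ p * (Real.exp (-t) * t ^ (ν - 1 / 2))
          + 2 ^ p * z ^ (-p) * (Real.exp (-t) * t ^ (ν - 1 / 2 + p))) := by
          refine norm_integral_le_of_norm_le ((hg1.const_mul _).add (hg2.const_mul _)) ?_
          filter_upwards [self_mem_ae_restrict measurableSet_Ioi] with t ht
          have ht' : (0 : ℝ) < t := ht
          have hw : (t / (2 * z)) ^ p ≤ t ^ p * z ^ (-p) := by
            rw [Real.rpow_neg hz.le, ← div_eq_mul_inv, ← Real.div_rpow ht'.le hz.le]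
            gcongr
            linarith
          rw [norm_mul, Complex.norm_real, Real.norm_of_nonneg (by positivity),
            Real.rpow_add ht']
          calc _ ≤ Real.exp (-t) * t ^ (ν - 1 / 2) * (2 ^ p * (1 + t ^ p * z ^ (-p))) := by
                gcongr
                refine (norm_one_add_I_mul_cpow_le (by positivity) hp hνp).trans ?_
                gcongr
            _ = _ := by ring
      _ = 2 ^ p * A + 2 ^ p * z ^ (-p) * B := by
          rw [integral_add (hg1.const_mul _) (hg2.const_mul _), integral_const_mul,
            integral_const_mul]
      _ ≤ _ := by
          have : 0 ≤ (2 : ℝ) ^ p * (A * z ^ (-p) + B) := by positivity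
          linarith
  refine ⟨Real.sqrt (2 / Real.pi) * |Real.Gamma (ν + 1 / 2)|⁻¹ * (2 ^ p * (A + B)),
    by positivity, fun z hz => ?_⟩
  have hs : Real.sqrt (2 / (Real.pi * z)) = Real.sqrt (2 / Real.pi) * z ^ (-(1 / 2) : ℝ) := by
    rw [← div_div, Real.sqrt_div' _ hz.le, Real.rpow_neg hz.le, ← Real.sqrt_eq_rpow, div_eq_mul_inv]
  have he : ‖Complex.exp (Complex.I * ((z - ν * Real.pi / 2 - Real.pi / 4 : ℝ) : ℂ))‖ = 1 := by
    rw [mul_comm]; exact Complex.norm_exp_ofReal_mul_I _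
  unfold hankelOne
  rw [norm_mul, norm_div, norm_mul, he, Complex.norm_real, Complex.norm_real,
    Real.norm_of_nonneg (Real.sqrt_nonneg _), hs, mul_one, Real.norm_eq_abs, div_eq_mul_inv]
  calc _ ≤ Real.sqrt (2 / Real.pi) * z ^ (-(1 / 2) : ℝ) * |Real.Gamma (ν + 1 / 2)|⁻¹
        * (2 ^ p * (A + B) * (1 + z ^ (-p))) := by
        gcongr
        exact hint z hz
    _ = _ := by
        rw [sub_eq_add_neg _ p, Real.rpow_add hz]
        ring

theorem measurable_hankelOne (ν : ℝ) : Measurable (hankelOne ν) := by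
  unfold hankelOne
  refine Measurable.mul (by fun_prop) ?_
  refine (StronglyMeasurable.integral_prod_right (ν := volume.restrict (Set.Ioi (0 : ℝ)))
    (f := fun z t : ℝ => ((Real.exp (-t) * t ^ (ν - 1 / 2) : ℝ) : ℂ)
        * (1 + Complex.I * ((t / (2 * z) : ℝ) : ℂ)) ^ ((ν - 1 / 2 : ℝ) : ℂ)) ?_).measurable
  apply Measurable.stronglyMeasurable
  unfold Function.uncurry
  fun_prop

theorem measurable_helmholtzFund {N : ℕ} (k : ℝ) :
    Measurable (helmholtzFund k : EuclideanSpace ℝ (Fin N) → ℂ) := by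
  have := (measurable_hankelOne (((N : ℝ) - 2) / 2)).comp
    (measurable_norm.const_mul k : Measurable fun x : EuclideanSpace ℝ (Fin N) => k * ‖x‖)
  unfold helmholtzFund
  exact Measurable.mul (by fun_prop) this

/-- The prefactor contributes `|x|^{-ν}`, which turns `|x|^{-1/2}` into `|x|^{-(N-1)/2}`. Choosing
`p = max (ν - 1/2) 0` gives the Newtonian order `N - 2` at the origin for `N ≥ 3`; for `N = 2` it
gives `|x|^{-1/2}`, cruder than the logarithm but still integrable. -/
theorem exists_norm_helmholtzFund_le {N : ℕ} (hN : 2 ≤ N) {k : ℝ} (hk : 0 < k) :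
    ∃ C : ℝ, 0 ≤ C ∧ ∀ x : EuclideanSpace ℝ (Fin N), x ≠ 0 →
      ‖helmholtzFund k x‖ ≤ C * (‖x‖ ^ (-(((N : ℝ) - 1) / 2))
        + ‖x‖ ^ (-(((N : ℝ) - 1) / 2 + max (((N : ℝ) - 3) / 2) 0))) := by
  have hN' : (2 : ℝ) ≤ N := by exact_mod_cast hN
  set ν : ℝ := ((N : ℝ) - 2) / 2 with hν
  set p : ℝ := max (((N : ℝ) - 3) / 2) 0 with hp
  obtain ⟨C, hC, h⟩ := exists_norm_hankelOne_le (ν := ν) (p := p) (by linarith) (le_max_right _ _)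
    (le_trans (by linarith) (le_max_left _ _))
  set K : ℝ := k ^ (-(1 / 2) : ℝ) + k ^ (-(1 / 2) - p) with hK
  refine ⟨1 / 4 * (k / (2 * Real.pi)) ^ ν * (C * K), by positivity, fun x hx => ?_⟩
  have hr : 0 < ‖x‖ := norm_pos_iff.2 hx
  have hz := h (k * ‖x‖) (by positivity)
  have e1 : (k / (2 * Real.pi * ‖x‖)) ^ ν = (k / (2 * Real.pi)) ^ ν * ‖x‖ ^ (-ν) := by
    rw [← div_div, Real.div_rpow (by positivity) hr.le, Real.rpow_neg hr.le, div_eq_mul_inv]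
  have e2 : ∀ q : ℝ, ‖x‖ ^ (-ν) * ‖x‖ ^ q = ‖x‖ ^ (-ν + q) := fun q => (Real.rpow_add hr _ _).symm
  -- Since `K` is the sum of both powers of `k`, expanding the right side leaves only nonnegative
  -- cross terms to discard.
  have e3 : (k * ‖x‖) ^ (-(1 / 2) : ℝ) + (k * ‖x‖) ^ (-(1 / 2) - p)
      ≤ K * (‖x‖ ^ (-(1 / 2) : ℝ) + ‖x‖ ^ (-(1 / 2) - p)) := by
    rw [Real.mul_rpow hk.le hr.le, Real.mul_rpow hk.le hr.le, hK]
    have : 0 ≤ k ^ (-(1 / 2) : ℝ) * ‖x‖ ^ (-(1 / 2) - p)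
      + k ^ (-(1 / 2) - p) * ‖x‖ ^ (-(1 / 2) : ℝ) := by positivity
    linarith
  have hn : ‖helmholtzFund k x‖
      = 1 / 4 * ((k / (2 * Real.pi)) ^ ν * ‖x‖ ^ (-ν)) * ‖hankelOne ν (k * ‖x‖)‖ := by
    unfold helmholtzFund
    rw [norm_mul, norm_mul, Complex.norm_real, Real.norm_of_nonneg (by positivity), ← hν, e1]
    norm_num
  rw [hn]
  calc _ ≤ 1 / 4 * ((k / (2 * Real.pi)) ^ ν * ‖x‖ ^ (-ν))
        * (C * (K * (‖x‖ ^ (-(1 / 2) : ℝ) + ‖x‖ ^ (-(1 / 2) - p)))) := by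
        gcongr
        exact hz.trans (by gcongr)
    _ = 1 / 4 * (k / (2 * Real.pi)) ^ ν * (C * K) * (‖x‖ ^ (-ν) * ‖x‖ ^ (-(1 / 2) : ℝ)
        + ‖x‖ ^ (-ν) * ‖x‖ ^ (-(1 / 2) - p)) := by ring
    _ = _ := by
        rw [e2, e2, hν]
        ring_nf

/-! ### Weights and absolute convergence of the convolution -/

theorem one_le_japaneseBracket {N : ℕ} (x : EuclideanSpace ℝ (Fin N)) : 1 ≤ japaneseBracket x :=
  Real.one_le_sqrt.2 (by nlinarith [sq_nonneg ‖x‖])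

theorem japaneseBracket_pos {N : ℕ} (x : EuclideanSpace ℝ (Fin N)) : 0 < japaneseBracket x :=
  one_pos.trans_le (one_le_japaneseBracket x)

theorem japaneseBracket_le_one_add_norm {N : ℕ} (x : EuclideanSpace ℝ (Fin N)) :
    japaneseBracket x ≤ 1 + ‖x‖ :=
  Real.sqrt_le_iff.2 ⟨by positivity, by nlinarith [norm_nonneg x]⟩

theorem continuous_japaneseBracket {N : ℕ} :
    Continuous (japaneseBracket : EuclideanSpace ℝ (Fin N) → ℝ) := by
  unfold japaneseBracket
  fun_prop

theorem continuous_japaneseBracket_rpow {N : ℕ} (β : ℝ) :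
    Continuous (fun x : EuclideanSpace ℝ (Fin N) => japaneseBracket x ^ β) :=
  continuous_japaneseBracket.rpow_const fun x => Or.inl (japaneseBracket_pos x).ne'

theorem integrable_japaneseBracket_rpow_neg {N : ℕ} {r : ℝ} (hr : (N : ℝ) < r) :
    Integrable (fun x : EuclideanSpace ℝ (Fin N) => japaneseBracket x ^ (-r)) := by
  have := integrable_rpow_neg_one_add_norm_sq (E := EuclideanSpace ℝ (Fin N)) (μ := volume)
    (r := r) (by simpa using hr)
  refine this.congr (Filter.Eventually.of_forall fun x => ?_)
  simp only [japaneseBracket]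
  rw [Real.sqrt_eq_rpow, ← Real.rpow_mul (by positivity)]
  ring_nf

/-- In polar coordinates the Jacobian makes the radial exponent `N - 1 - s`, which exceeds `-1`. -/
theorem integrableOn_ball_norm_rpow_neg {N : ℕ} (hN : 1 ≤ N) {s : ℝ} (hs : s < N) :
    IntegrableOn (fun x : EuclideanSpace ℝ (Fin N) => ‖x‖ ^ (-s)) (Metric.ball 0 1) := by
  have : NeZero N := ⟨by omega⟩
  rw [integrableOn_fun_norm_addHaar volume (f := fun r : ℝ => r ^ (-s)), finrank_euclideanSpace_fin]
  have h : IntegrableOn (fun y : ℝ => y ^ ((N : ℝ) - 1 - s)) (Set.Ioo 0 1) :=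
    (intervalIntegral.integrableOn_Ioo_rpow_iff one_pos).2 (by linarith)
  refine h.congr_fun (fun y hy => ?_) measurableSet_Ioo
  have hy : 0 < y := hy.1
  simp only [smul_eq_mul]
  rw [← Real.rpow_natCast, ← Real.rpow_add hy, Nat.cast_sub hN]
  simp [sub_eq_add_neg]

/-- A Riesz-type singularity against a decaying weight is absolutely convolvable at every point. -/
theorem integrable_norm_rpow_neg_mul_japaneseBracket {N : ℕ} (hN : 1 ≤ N) {s α : ℝ} (hs : 0 ≤ s)
    (hsN : s < N) (hsα : N < s + α) (x : EuclideanSpace ℝ (Fin N)) :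
    Integrable (fun t : EuclideanSpace ℝ (Fin N) =>
      ‖t‖ ^ (-s) * japaneseBracket (x - t) ^ (-α)) := by
  have hm : ∀ μ : Measure (EuclideanSpace ℝ (Fin N)), AEStronglyMeasurable
      (fun t : EuclideanSpace ℝ (Fin N) => ‖t‖ ^ (-s) * japaneseBracket (x - t) ^ (-α)) μ := by
    intro μ
    refine Measurable.aestronglyMeasurable (Measurable.mul (by fun_prop) ?_)
    exact ((continuous_japaneseBracket_rpow (-α)).comp
      (continuous_const.sub continuous_id)).measurable
  -- Inside the unit ball the weight is at most `1` and only the singularity matters. Outside,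
  -- `|t|^{-s}` is traded for `⟨x - t⟩^{-s}`, leaving a bracket to the power `-(s + α)`.
  rw [← integrableOn_univ, ← Set.union_compl_self (Metric.ball (0 : EuclideanSpace ℝ (Fin N)) 1)]
  refine IntegrableOn.union ?_ ?_
  · refine Integrable.mono' (integrableOn_ball_norm_rpow_neg hN hsN) (hm _)
      (Filter.Eventually.of_forall fun t => ?_)
    have := japaneseBracket_pos (x - t)
    rw [Real.norm_of_nonneg (by positivity)]
    exact mul_le_of_le_one_right (by positivity)
      (Real.rpow_le_one_of_one_le_of_nonpos (one_le_japaneseBracket _) (by linarith))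
  · have hi : Integrable (fun t : EuclideanSpace ℝ (Fin N) =>
        (2 + ‖x‖) ^ s * japaneseBracket (x - t) ^ (-(s + α))) :=
      ((integrable_japaneseBracket_rpow_neg hsα).comp_sub_left x).const_mul _
    refine Integrable.mono' hi.integrableOn (hm _) ?_
    filter_upwards [self_mem_ae_restrict Metric.isOpen_ball.measurableSet.compl] with t ht
    have ht1 : 1 ≤ ‖t‖ := by simpa using ht
    have hb := japaneseBracket_pos (x - t)
    rw [Real.norm_of_nonneg (by positivity), neg_add, Real.rpow_add hb, ← mul_assoc]
    gcongr
    -- From `1 + |x| + |t| ≤ (2 + |x|)|t|`, valid for `|t| ≥ 1`.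
    have h1 : japaneseBracket (x - t) ≤ (2 + ‖x‖) * ‖t‖ := by
      have h2 := japaneseBracket_le_one_add_norm (x - t)
      have h3 := norm_sub_le x t
      nlinarith [norm_nonneg x]
    have ht0 : 0 < ‖t‖ := by linarith
    rw [Real.rpow_neg hb.le, Real.rpow_neg ht0.le, ← div_eq_mul_inv, ← Real.div_rpow
      (by positivity) hb.le, ← Real.inv_rpow ht0.le]
    gcongr
    rw [inv_eq_one_div, div_le_div_iff₀ ht0 hb]
    linarith

theorem integrable_norm_helmholtzFund_mul_japaneseBracket {N : ℕ} (hN : 2 ≤ N) {k : ℝ}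
    (hk : 0 < k) {α : ℝ} (hα : ((N : ℝ) + 1) / 2 < α) (x : EuclideanSpace ℝ (Fin N)) :
    Integrable (fun t : EuclideanSpace ℝ (Fin N) =>
      ‖helmholtzFund k t‖ * japaneseBracket (x - t) ^ (-α)) := by
  have hN' : (2 : ℝ) ≤ N := by exact_mod_cast hN
  have : NeZero N := ⟨by omega⟩
  obtain ⟨C, hC, h⟩ := exists_norm_helmholtzFund_le hN hk
  have hp0 : 0 ≤ max (((N : ℝ) - 3) / 2) 0 := le_max_right _ _
  have hp1 : max (((N : ℝ) - 3) / 2) 0 < ((N : ℝ) + 1) / 2 := max_lt (by linarith) (by linarith)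
  have i1 := integrable_norm_rpow_neg_mul_japaneseBracket (N := N) (s := ((N : ℝ) - 1) / 2) (α := α)
    (by omega) (by linarith) (by linarith) (by linarith) x
  have i2 := integrable_norm_rpow_neg_mul_japaneseBracket (N := N)
    (s := ((N : ℝ) - 1) / 2 + max (((N : ℝ) - 3) / 2) 0) (α := α)
    (by omega) (by linarith) (by linarith) (by linarith) x
  refine Integrable.mono' ((i1.add i2).const_mul C) ?_ ?_
  · refine Measurable.aestronglyMeasurable (Measurable.mul (measurable_helmholtzFund k).norm ?_)
    exact ((continuous_japaneseBracket_rpow (-α)).comp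
      (continuous_const.sub continuous_id)).measurable
  -- The pointwise bound is only available off the origin, a null set.
  · filter_upwards [compl_mem_ae_iff.2 (measure_singleton (0 : EuclideanSpace ℝ (Fin N)))]
      with t ht
    have hb := japaneseBracket_pos (x - t)
    rw [Real.norm_of_nonneg (by positivity), Pi.add_apply, ← add_mul, ← mul_assoc]
    gcongr
    exact h t ht

/-! ### What the constants `ℓ_α` and `κ_α` control -/

theorem norm_sub_le_weightedLipConst {N : ℕ} {α : ℝ} {f : EuclideanSpace ℝ (Fin N) → ℂ → ℂ}
    (hf : weightedLipConst α f ≠ ∞) (x : EuclideanSpace ℝ (Fin N)) (u v : ℂ) :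
    ‖f x u - f x v‖ ≤ (weightedLipConst α f).toReal * ‖u - v‖ * japaneseBracket x ^ (-α) := by
  rcases eq_or_ne u v with rfl | huv
  · simp
  have hb := japaneseBracket_pos x
  have h : ENNReal.ofReal (japaneseBracket x ^ α * ‖(f x u - f x v) / (u - v)‖)
      ≤ weightedLipConst α f :=
    le_iSup_of_le x <| le_iSup_of_le u <| le_iSup_of_le v <| le_iSup_of_le huv le_rfl
  have h' := (ENNReal.ofReal_le_iff_le_toReal hf).1 h
  have huv' : 0 < ‖u - v‖ := norm_pos_iff.2 (sub_ne_zero.2 huv)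
  rw [norm_div, ← mul_div_assoc, div_le_iff₀ huv'] at h'
  rwa [Real.rpow_neg hb.le, ← div_eq_mul_inv, le_div_iff₀ (by positivity), mul_comm]

/-- This is the only property of `τ(α)` that is needed: the weight in the target norm is at least
`1`, so `L^∞_{τ(α)}` bounds are `L^∞` bounds. -/
theorem decayExponent_nonneg {N : ℕ} (hN : 1 ≤ N) {α : ℝ} (hα : ((N : ℝ) + 1) / 2 < α) :
    0 ≤ decayExponent N α := by
  have hN' : (1 : ℝ) ≤ N := by exact_mod_cast hN
  unfold decayExponent
  split_ifs <;> linarith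

/-- The constant `κ_α` bounds the convolution of `|Φ_k|` with the extremal weight `⟨·⟩^{-α}`. -/
theorem ae_integral_norm_helmholtzFund_le_kappaConst {N : ℕ} (hN : 1 ≤ N) {k α : ℝ}
    (hα : ((N : ℝ) + 1) / 2 < α) (hκ : kappaConst N k α ≠ ∞) :
    ∀ᵐ x : EuclideanSpace ℝ (Fin N),
      ∫ t, ‖helmholtzFund k t‖ * japaneseBracket (x - t) ^ (-α) ≤ (kappaConst N k α).toReal := by
  have : NeZero N := ⟨by omega⟩
  -- This `w` dominates every function of unit norm in `L^∞_α`, and its own norm is exactly `1`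
  -- because `⟨x⟩^α w(x) = 1` identically.
  set w : EuclideanSpace ℝ (Fin N) → ℂ := fun x => ((japaneseBracket x ^ (-α) : ℝ) : ℂ) with hw
  have hwm : AEStronglyMeasurable w volume :=
    (Complex.continuous_ofReal.comp (continuous_japaneseBracket_rpow (-α))).aestronglyMeasurable
  have hw1 : weightedSupNorm α w = 1 := by
    have : (fun x => japaneseBracket x ^ α • w x) = fun _ => (1 : ℂ) := by
      ext x
      have hb := japaneseBracket_pos x
      rw [hw, Complex.real_smul, ← Complex.ofReal_mul, ← Real.rpow_add hb]
      simp
    unfold weightedSupNorm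
    rw [this, eLpNorm_exponent_top, eLpNormEssSup_const _ (NeZero.ne _)]
    simp
  have hle : weightedSupNorm (decayExponent N α)
      (convolution (fun x => ‖helmholtzFund k x‖) w (ContinuousLinearMap.lsmul ℝ ℝ) volume)
      ≤ kappaConst N k α :=
    le_iSup_of_le w <| le_iSup_of_le hwm <| le_iSup_of_le hw1 le_rfl
  have hae : ∀ᵐ x : EuclideanSpace ℝ (Fin N), ‖japaneseBracket x ^ decayExponent N α •
      convolution (fun x => ‖helmholtzFund k x‖) w (ContinuousLinearMap.lsmul ℝ ℝ) volume x‖ₑ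
      ≤ kappaConst N k α := by
    filter_upwards [ae_le_eLpNormEssSup (μ := volume)
      (f := fun x : EuclideanSpace ℝ (Fin N) => japaneseBracket x ^ decayExponent N α •
      convolution (fun x => ‖helmholtzFund k x‖) w (ContinuousLinearMap.lsmul ℝ ℝ) volume x)]
      with x hx
    refine hx.trans (le_trans (le_of_eq ?_) hle)
    rw [weightedSupNorm, eLpNorm_exponent_top]
  filter_upwards [hae] with x hx
  have hconv : convolution (fun x => ‖helmholtzFund k x‖) w (ContinuousLinearMap.lsmul ℝ ℝ)
      volume x = ((∫ t, ‖helmholtzFund k t‖ * japaneseBracket (x - t) ^ (-α) : ℝ) : ℂ) := by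
    rw [convolution, ← integral_complex_ofReal]
    refine integral_congr_ae (Filter.Eventually.of_forall fun t => ?_)
    simp [hw]
  have hb := japaneseBracket_pos x
  have h1 : 1 ≤ japaneseBracket x ^ decayExponent N α :=
    Real.one_le_rpow (one_le_japaneseBracket x) (decayExponent_nonneg hN hα)
  have hG : 0 ≤ ∫ t, ‖helmholtzFund k t‖ * japaneseBracket (x - t) ^ (-α) :=
    integral_nonneg fun t => by
      have := japaneseBracket_pos (x - t)
      positivity
  rw [hconv, ← ofReal_norm, ENNReal.ofReal_le_iff_le_toReal hκ, norm_smul, Complex.norm_real,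
    Real.norm_of_nonneg hG, Real.norm_of_nonneg (by positivity)] at hx
  -- The factor `⟨x⟩^{τ(α)} ≥ 1` is dropped here.
  exact (le_mul_of_one_le_left hG h1).trans hx

/-! ### The resolvent on functions dominated by the weight -/

section Resolvent

variable {N : ℕ} {k α M : ℝ} {h : EuclideanSpace ℝ (Fin N) → ℂ}

/-- The reflection `t ↦ x - t` preserves null sets, so an a.e. bound on `h` is usable for every `x`,
not just almost every one. -/
theorem ae_norm_helmholtzFund_mul_le
    (hb : ∀ᵐ y, ‖h y‖ ≤ M * japaneseBracket y ^ (-α)) (x : EuclideanSpace ℝ (Fin N)) :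
    ∀ᵐ t, ‖ContinuousLinearMap.mul ℂ ℂ (helmholtzFund k t) (h (x - t))‖
      ≤ M * (‖helmholtzFund k t‖ * japaneseBracket (x - t) ^ (-α)) := by
  filter_upwards [(quasiMeasurePreserving_sub_left_of_right_invariant volume x).ae hb] with t ht
  rw [ContinuousLinearMap.mul_apply', norm_mul, mul_left_comm]
  gcongr

theorem convolutionExists_helmholtzFund (hN : 2 ≤ N) (hk : 0 < k)
    (hα : ((N : ℝ) + 1) / 2 < α) (hm : AEStronglyMeasurable h volume)
    (hb : ∀ᵐ y, ‖h y‖ ≤ M * japaneseBracket y ^ (-α)) :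
    ConvolutionExists (helmholtzFund k) h (ContinuousLinearMap.mul ℂ ℂ) volume := fun x =>
  Integrable.mono' ((integrable_norm_helmholtzFund_mul_japaneseBracket hN hk hα x).const_mul M)
    ((measurable_helmholtzFund k).aestronglyMeasurable.convolution_integrand_snd _ hm x)
    (ae_norm_helmholtzFund_mul_le hb x)

theorem aestronglyMeasurable_helmholtzResolvent (hm : AEStronglyMeasurable h volume) :
    AEStronglyMeasurable (helmholtzResolvent k h) volume :=
  ((measurable_helmholtzFund k).aestronglyMeasurable.convolution_integrand
    (ContinuousLinearMap.mul ℂ ℂ) hm (μ := volume) (ν := volume)).integral_prod_right'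

/-- Integrability of the majorant, known at every `x`, makes the comparison of integrals legitimate;
`κ_α` then bounds the integral of the majorant for a.e. `x`. -/
theorem ae_norm_helmholtzResolvent_le (hN : 2 ≤ N) (hk : 0 < k) (hα : ((N : ℝ) + 1) / 2 < α)
    (hκ : kappaConst N k α ≠ ∞) (hM : 0 ≤ M)
    (hb : ∀ᵐ y, ‖h y‖ ≤ M * japaneseBracket y ^ (-α)) :
    ∀ᵐ x, ‖helmholtzResolvent k h x‖ ≤ M * (kappaConst N k α).toReal := by
  filter_upwards [ae_integral_norm_helmholtzFund_le_kappaConst (by omega) hα hκ] with x hx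
  refine (norm_integral_le_of_norm_le
    ((integrable_norm_helmholtzFund_mul_japaneseBracket hN hk hα x).const_mul M)
    (ae_norm_helmholtzFund_mul_le hb x)).trans ?_
  rw [integral_const_mul]
  gcongr

theorem helmholtzResolvent_sub {g : EuclideanSpace ℝ (Fin N) → ℂ}
    (hg : ConvolutionExists (helmholtzFund k) g (ContinuousLinearMap.mul ℂ ℂ) volume)
    (hh : ConvolutionExists (helmholtzFund k) h (ContinuousLinearMap.mul ℂ ℂ) volume)
    (x : EuclideanSpace ℝ (Fin N)) :
    helmholtzResolvent k g x - helmholtzResolvent k h x = helmholtzResolvent k (g - h) x := by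
  unfold helmholtzResolvent convolution
  rw [← integral_sub (hg x) (hh x)]
  simp [mul_sub]

end Resolvent

/-! ### The substitution operator on `L^∞` -/

section Substitution

variable {N : ℕ} {α : ℝ} {f : EuclideanSpace ℝ (Fin N) → ℂ → ℂ}

theorem ae_norm_coe_le_norm (u : Lp ℂ ∞ (volume : Measure (EuclideanSpace ℝ (Fin N)))) :
    ∀ᵐ x, ‖u x‖ ≤ ‖u‖ := by
  filter_upwards [ae_le_eLpNormEssSup (f := u) (μ := volume)] with x hx
  rw [← eLpNorm_exponent_top, ← ofReal_norm,
    ENNReal.ofReal_le_iff_le_toReal (Lp.eLpNorm_ne_top u)] at hx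
  exact hx

theorem aestronglyMeasurable_substitution
    (hf : Continuous (fun p : EuclideanSpace ℝ (Fin N) × ℂ => f p.1 p.2))
    {u : EuclideanSpace ℝ (Fin N) → ℂ} (hu : AEStronglyMeasurable u volume) :
    AEStronglyMeasurable (substitution f u) volume :=
  hf.comp_aestronglyMeasurable (aestronglyMeasurable_id.prodMk hu)

theorem exists_ae_norm_substitution_le
    (hf_bound : ∀ M : ℝ, 0 < M → ∃ C : ℝ, ∀ (x : EuclideanSpace ℝ (Fin N)) (u : ℂ),
      ‖u‖ ≤ M → japaneseBracket x ^ α * ‖f x u‖ ≤ C)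
    (u : Lp ℂ ∞ (volume : Measure (EuclideanSpace ℝ (Fin N)))) :
    ∃ M : ℝ, 0 ≤ M ∧ ∀ᵐ y, ‖substitution f u y‖ ≤ M * japaneseBracket y ^ (-α) := by
  -- The `+ 1` keeps the radius positive when `u = 0`.
  obtain ⟨C, hC⟩ := hf_bound (‖u‖ + 1) (by positivity)
  refine ⟨max C 0, le_max_right _ _, ?_⟩
  filter_upwards [ae_norm_coe_le_norm u] with y hy
  have hb := japaneseBracket_pos y
  have h1 := (hC y (u y) (by linarith)).trans (le_max_left C 0)
  rwa [Real.rpow_neg hb.le, ← div_eq_mul_inv, le_div_iff₀ (by positivity), mul_comm]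

end Substitution

/-! ### The contraction argument -/

theorem theorem6p3 (N : ℕ) (hN : 2 ≤ N) (k : ℝ) (hk : 0 < k)
    (α : ℝ) (hα : ((N : ℝ) + 1) / 2 < α)
    (f : EuclideanSpace ℝ (Fin N) → ℂ → ℂ)
    (hf : Continuous (fun p : EuclideanSpace ℝ (Fin N) × ℂ => f p.1 p.2))
    (hf_bound : ∀ M : ℝ, 0 < M → ∃ C : ℝ, ∀ (x : EuclideanSpace ℝ (Fin N)) (u : ℂ),
      ‖u‖ ≤ M → japaneseBracket x ^ α * ‖f x u‖ ≤ C)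
    (hf_lip : weightedLipConst α f < (kappaConst N k α)⁻¹) :
    (∀ u : Lp ℂ ∞ (volume : Measure (EuclideanSpace ℝ (Fin N))),
      ConvolutionExists (helmholtzFund k) (substitution f u) (ContinuousLinearMap.mul ℂ ℂ)
        volume) ∧
    ∀ φ : Lp ℂ ∞ (volume : Measure (EuclideanSpace ℝ (Fin N))),
      ∃! u : Lp ℂ ∞ (volume : Measure (EuclideanSpace ℝ (Fin N))),
        u =ᵐ[volume] fun x => helmholtzResolvent k (substitution f u) x + φ x := by
  -- With `∞⁻¹ = 0`, an infinite `κ_α` would force `ℓ_α < 0`.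
  have hκ : kappaConst N k α ≠ ∞ := by
    intro h
    simp [h] at hf_lip
  have hℓ : weightedLipConst α f ≠ ∞ := hf_lip.ne_top
  have hlt : weightedLipConst α f * kappaConst N k α < 1 := by
    rcases eq_or_ne (kappaConst N k α) 0 with h0 | h0
    · simp [h0]
    · rwa [← ENNReal.lt_div_iff_mul_lt (Or.inl h0) (Or.inl hκ), one_div]
  have hsm : ∀ u : Lp ℂ ∞ (volume : Measure (EuclideanSpace ℝ (Fin N))),
      AEStronglyMeasurable (substitution f u) volume := fun u =>
    aestronglyMeasurable_substitution hf (Lp.aestronglyMeasurable u)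
  have hce : ∀ u : Lp ℂ ∞ (volume : Measure (EuclideanSpace ℝ (Fin N))),
      ConvolutionExists (helmholtzFund k) (substitution f u) (ContinuousLinearMap.mul ℂ ℂ)
        volume := fun u => by
    obtain ⟨M, -, hM⟩ := exists_ae_norm_substitution_le hf_bound u
    exact convolutionExists_helmholtzFund hN hk hα (hsm u) hM
  refine ⟨hce, fun φ => ?_⟩
  have hmem : ∀ u : Lp ℂ ∞ (volume : Measure (EuclideanSpace ℝ (Fin N))),
      MemLp (fun x => helmholtzResolvent k (substitution f u) x + φ x) ∞ volume := fun u => by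
    obtain ⟨M, hM0, hM⟩ := exists_ae_norm_substitution_le hf_bound u
    exact (memLp_top_of_bound (aestronglyMeasurable_helmholtzResolvent (hsm u)) _
      (ae_norm_helmholtzResolvent_le hN hk hα hκ hM0 hM)).add (Lp.memLp φ)
  set T : Lp ℂ ∞ (volume : Measure (EuclideanSpace ℝ (Fin N))) → Lp ℂ ∞ volume :=
    fun u => (hmem u).toLp _
  -- Elements of `Lp` are a.e. classes, so equality in `Lp` is exactly the a.e. equation.
  have hfix : ∀ u, Function.IsFixedPt T u ↔
      u =ᵐ[volume] fun x => helmholtzResolvent k (substitution f u) x + φ x := fun u =>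
    ⟨fun h => by
      have := (hmem u).coeFn_toLp
      rwa [show (hmem u).toLp _ = u from h] at this,
    fun h => Lp.ext ((hmem u).coeFn_toLp.trans h.symm)⟩
  have hT : ContractingWith (weightedLipConst α f * kappaConst N k α).toNNReal T := by
    refine ⟨by rw [← ENNReal.coe_lt_coe, ENNReal.coe_toNNReal (hlt.trans ENNReal.one_lt_top).ne]
               simpa using hlt, LipschitzWith.of_dist_le_mul fun u v => ?_⟩
    rw [dist_eq_norm, dist_eq_norm, ENNReal.coe_toNNReal_eq_toReal, ENNReal.toReal_mul]
    have hd : ∀ᵐ y, ‖(substitution f u - substitution f v) y‖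
        ≤ (weightedLipConst α f).toReal * ‖u - v‖ * japaneseBracket y ^ (-α) := by
      filter_upwards [ae_norm_coe_le_norm (u - v), Lp.coeFn_sub u v] with y hy hsub
      have hb := japaneseBracket_pos y
      rw [hsub, Pi.sub_apply] at hy
      refine (norm_sub_le_weightedLipConst hℓ y (u y) (v y)).trans ?_
      gcongr
    -- The resolvent bound is applied to the difference of the nonlinear terms, with `M = ℓ_α ‖u -
    -- v‖`.
    have hR := ae_norm_helmholtzResolvent_le hN hk hα hκ (by positivity) hd
    rw [mul_right_comm]
    have hle : ∀ᵐ x, ‖(T u - T v) x‖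
        ≤ (weightedLipConst α f).toReal * ‖u - v‖ * (kappaConst N k α).toReal := by
      filter_upwards [hR, Lp.coeFn_sub (T u) (T v), (hmem u).coeFn_toLp, (hmem v).coeFn_toLp]
        with x hx hs hu hv
      -- `φ` cancels, and the two resolvents combine because both convolutions converge absolutely.
      rw [hs, Pi.sub_apply, hu, hv, add_sub_add_right_eq_sub,
        helmholtzResolvent_sub (hce u) (hce v)]
      exact hx
    rw [Lp.norm_def, eLpNorm_exponent_top]
    exact ENNReal.toReal_le_of_le_ofReal (by positivity) (eLpNormEssSup_le_of_ae_bound hle)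
  exact ⟨ContractingWith.fixedPoint T hT, (hfix _).1 hT.fixedPoint_isFixedPt,
    fun v hv => hT.fixedPoint_unique ((hfix v).2 hv)⟩
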